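/- Let $p,q,r$ be positive real numbers with $p+q+r=1$, and let $p',r',q'',r''$ be positive real numbers with $p'+r'=1$ and $q''+r''=1$. Consider the Markov chain on the quadrant $\{(i,j): i,j\in\mathbb{Z},\ i,j\ge 0\}$ whose only nonzero transition probabilities $T(i,j;k,\ell)$ are the following. - For $i,j>0$: $T(i,j;i-1,j)=p$, $T(i,j;i,j-1)=q$, $T(i,j;i+1,j+1)=r$. - For $i>0$: $T(i,0;i-1,0)=p'$, $T(i,0;i+1,1)=r'$. - For $j>0$: $T(0,j;0,j-1)=q''$, $T(0,j;1,j+1)=r''$. - $T(0,0;1,1)=1$. Assume the boundary conditions $$\frac pr=\frac{p'}{r'}\qquad\text{and}\qquad \frac qr=\frac{q''}{r''}.$$ Then the chain is ergodic, that is, there is a probability distribution $(p_{i,j})_{i,j\ge0}$ with $p_{k,\ell}=\sum_{i,j\ge 0}p_{i,j}\,T(i,j;k,\ell)$ for all $k,\ell\ge0$, if and only if $r<\min(p,q)$. -/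

import Mathlib

namespace QuadrantChain

/-- Transition probabilities `T(i,j;k,l)` of the chain on the quadrant `ℕ × ℕ`.
In the interior the chain makes a West, South or North-East step with probability `p`, `q`, `r`;
on the positive x-axis a West or North-East step with probability `p'`, `r'`;
on the positive y-axis a South or North-East step with probability `q''`, `r''`;
at the origin it makes a North-East step. -/
def transition (p q r p' r' q'' r'' : ℝ) : ℕ × ℕ → ℕ × ℕ → ℝ
  | (i + 1, j + 1), t =>
      if t = (i, j + 1) then p else if t = (i + 1, j) then q
      else if t = (i + 2, j + 2) then r else 0
  | (i + 1, 0), t => if t = (i, 0) then p' else if t = (i + 2, 1) then r' else 0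
  | (0, j + 1), t => if t = (0, j) then q'' else if t = (1, j + 2) then r'' else 0
  | (0, 0), t => if t = (1, 1) then 1 else 0

/-- A probability distribution on the countable state space `S` that is stationary for the
transition probabilities `T`. -/
structure IsStationaryDistribution {S : Type*} (T : S → S → ℝ) (π : S → ℝ) : Prop where
  nonneg : ∀ s, 0 ≤ π s
  hasSum_one : HasSum π 1
  stationary : ∀ t, HasSum (fun s => π s * T s t) (π t)

/-- A chain is called ergodic if it has a stationary distribution. -/
def IsErgodicChain {S : Type*} (T : S → S → ℝ) : Prop :=
  ∃ π : S → ℝ, IsStationaryDistribution T π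

end QuadrantChain

namespace QuadrantChain

open Filter Topology

/-! The boundary conditions make the chain the jump chain of a continuous-time chain with rates `p`
West, `q` South, `r` North-East, where steps leaving the quadrant are suppressed. Stationary laws
then correspond to summable balanced measures of nonzero mass. Each coordinate alone is a
birth-death chain, so its marginal is geometric with ratio `r / p` or `r / q`
(`IsBalanced.marginal`), and summability forces `r < p` and `r < q`. Conversely, uniformize, so that
suppressed steps become pauses, and start at the origin. The joint tails increase with time and stay
below the geometric tails fixed by `tailStep`. Their limit is a fixed point, hence has balanced
mass, and the geometric bounds stop mass from escaping (`exists_isBalanced`). -/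

/-- Total jump rate at a state of the continuous-time chain that goes West at rate `p` (off the
y-axis), South at rate `q` (off the x-axis) and North-East at rate `r`. -/
def totalRate (p q r : ℝ) (s : ℕ × ℕ) : ℝ :=
  r + (if s.1 = 0 then 0 else p) + (if s.2 = 0 then 0 else q)

/-- The mass that `μ` puts on the South-West neighbour of a state. -/
def southWest (μ : ℕ × ℕ → ℝ) : ℕ × ℕ → ℝ
  | (k + 1, l + 1) => μ (k, l)
  | _ => 0

/-- Global balance equations of the continuous-time chain. -/
def IsBalanced (p q r : ℝ) (μ : ℕ × ℕ → ℝ) : Prop :=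
  ∀ k l, totalRate p q r (k, l) * μ (k, l) =
    p * μ (k + 1, l) + q * μ (k, l + 1) + r * southWest μ (k, l)

theorem totalRate_le_one {p q r : ℝ} (hp : 0 < p) (hq : 0 < q) (h : p + q + r = 1) (s : ℕ × ℕ) :
    totalRate p q r s ≤ 1 := by
  unfold totalRate; split_ifs <;> linarith

theorem le_totalRate {p q r : ℝ} (hp : 0 < p) (hq : 0 < q) (s : ℕ × ℕ) :
    r ≤ totalRate p q r s := by
  unfold totalRate; split_ifs <;> linarith

theorem IsBalanced.swap {p q r : ℝ} {μ : ℕ × ℕ → ℝ} (h : IsBalanced p q r μ) :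
    IsBalanced q p r (μ ∘ Prod.swap) := by
  intro k l
  have := h l k
  rcases k with _ | k <;> rcases l with _ | l <;>
    simp [totalRate, southWest] at this ⊢ <;> linarith

/-- The jump probabilities are the jump rates divided by the total rate. -/
theorem totalRate_mul_transition {p q r p' r' q'' r'' : ℝ}
    (hpqr : p + q + r = 1)
    (hp' : p' * (p + r) = p) (hr' : r' * (p + r) = r)
    (hq'' : q'' * (q + r) = q) (hr'' : r'' * (q + r) = r) (s t : ℕ × ℕ) :
    totalRate p q r s * transition p q r p' r' q'' r'' s t =
      (if s = (t.1 + 1, t.2) then p else 0) + (if s = (t.1, t.2 + 1) then q else 0) +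
        (if (s.1 + 1, s.2 + 1) = t then r else 0) := by
  obtain ⟨k, l⟩ := t
  rcases s with ⟨_ | i, _ | j⟩ <;>
    simp only [totalRate, transition, Prod.mk.injEq, Nat.add_eq_zero_iff, one_ne_zero, and_false,
      false_and, if_true, if_false, (Nat.succ_ne_zero _).symm] <;> split_ifs <;>
    first
    | omega
    | ring1
    | linear_combination hp'
    | linear_combination hr'
    | linear_combination hq''
    | linear_combination hr''
    | linear_combination p * hpqr
    | linear_combination q * hpqr
    | linear_combination r * hpqr

/-- The probability flow into a state. -/
theorem hasSum_flow {p q r p' r' q'' r'' : ℝ}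
    (hpqr : p + q + r = 1)
    (hp' : p' * (p + r) = p) (hr' : r' * (p + r) = r)
    (hq'' : q'' * (q + r) = q) (hr'' : r'' * (q + r) = r) (μ : ℕ × ℕ → ℝ) (k l : ℕ) :
    HasSum (fun s => totalRate p q r s * μ s * transition p q r p' r' q'' r'' s (k, l))
      (p * μ (k + 1, l) + q * μ (k, l + 1) + r * southWest μ (k, l)) := by
  have h1 : HasSum (fun s : ℕ × ℕ => if s = (k + 1, l) then p * μ (k + 1, l) else 0)
      (p * μ (k + 1, l)) := hasSum_ite_eq _ _
  have h2 : HasSum (fun s : ℕ × ℕ => if s = (k, l + 1) then q * μ (k, l + 1) else 0)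
      (q * μ (k, l + 1)) := hasSum_ite_eq _ _
  have h3 : HasSum (fun s : ℕ × ℕ => if (s.1 + 1, s.2 + 1) = (k, l) then r * μ s else 0)
      (r * southWest μ (k, l)) := by
    rcases k with _ | k
    · simp [southWest]
    rcases l with _ | l
    · simp [southWest]
    rw [southWest]
    convert hasSum_ite_eq (k, l) (r * μ (k, l)) using 2 with s
    obtain ⟨i, j⟩ := s
    simp only [Prod.mk.injEq, Nat.add_right_cancel_iff]
    split_ifs with h
    · rw [h.1, h.2]
    · rfl
  refine ((h1.add h2).add h3).congr_fun ?_
  intro s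
  rw [mul_right_comm, totalRate_mul_transition hpqr hp' hr' hq'' hr'']
  simp only [add_mul, ite_mul, zero_mul]
  congr 2
  · split_ifs with h
    · rw [h]
    · rfl
  · split_ifs with h
    · rw [h]
    · rfl

/-- Ergodicity of the jump chain is the existence of a summable balanced measure. -/
theorem isErgodicChain_iff_exists_isBalanced {p q r p' r' q'' r'' : ℝ}
    (hp : 0 < p) (hq : 0 < q) (hr : 0 < r) (hpqr : p + q + r = 1)
    (hp' : p' * (p + r) = p) (hr' : r' * (p + r) = r)
    (hq'' : q'' * (q + r) = q) (hr'' : r'' * (q + r) = r) :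
    IsErgodicChain (transition p q r p' r' q'' r'') ↔
      ∃ μ : ℕ × ℕ → ℝ, (∀ s, 0 ≤ μ s) ∧ Summable μ ∧ 0 < ∑' s, μ s ∧ IsBalanced p q r μ := by
  have hc (s) : 0 < totalRate p q r s := hr.trans_le (le_totalRate hp hq s)
  constructor
  · rintro ⟨π, h0, h1, hst⟩
    -- Dividing by the rate weights each state by its mean holding time. Rates at most 1 keep the
    -- total mass at least 1; rates at least `r` keep it finite.
    have hle (s) : π s ≤ π s / totalRate p q r s :=
      le_div_self (h0 s) (hc s) (totalRate_le_one hp hq hpqr s)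
    have hsum : Summable fun s => π s / totalRate p q r s := by
      refine Summable.of_nonneg_of_le (fun s => div_nonneg (h0 s) (hc s).le) (fun s => ?_)
        (h1.summable.div_const r)
      exact div_le_div_of_nonneg_left (h0 s) hr (le_totalRate hp hq s)
    refine ⟨fun s => π s / totalRate p q r s, fun s => div_nonneg (h0 s) (hc s).le, hsum, ?_, ?_⟩
    · have := h1.summable.tsum_le_tsum hle hsum
      rw [h1.tsum_eq] at this
      linarith
    · intro k l
      have h := hasSum_flow hpqr hp' hr' hq'' hr'' (fun s => π s / totalRate p q r s) k l
      simp only [mul_div_cancel₀ _ (hc _).ne'] at h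
      exact (mul_div_cancel₀ _ (hc _).ne').trans (h.unique (hst (k, l))).symm
  · rintro ⟨μ, h0, hsum, hpos, hb⟩
    have hsum' : Summable fun s => totalRate p q r s * μ s :=
      Summable.of_nonneg_of_le (fun s => mul_nonneg (hc s).le (h0 s))
        (fun s => mul_le_of_le_one_left (h0 s) (totalRate_le_one hp hq hpqr s)) hsum
    set C := ∑' s, totalRate p q r s * μ s with hC
    have hCpos : 0 < C := by
      have h := (hsum.mul_left r).tsum_le_tsum
        (fun s => mul_le_mul_of_nonneg_right (le_totalRate (r := r) hp hq s) (h0 s)) hsum'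
      rw [tsum_mul_left] at h
      exact (mul_pos hr hpos).trans_le h
    refine ⟨fun s => totalRate p q r s * μ s / C,
      fun s => div_nonneg (mul_nonneg (hc s).le (h0 s)) hCpos.le, ?_, ?_⟩
    · have h := hsum'.hasSum.div_const C
      rwa [← hC, div_self hCpos.ne'] at h
    · rintro ⟨k, l⟩
      have h := (hasSum_flow hpqr hp' hr' hq'' hr'' μ k l).div_const C
      rw [← hb k l] at h
      simpa only [div_mul_eq_mul_div] using h

/-! ### Necessity: geometric marginals -/

/-- The first marginal of a balanced measure satisfies detailed balance. -/
theorem IsBalanced.marginal {p q r : ℝ} {μ : ℕ × ℕ → ℝ} (hb : IsBalanced p q r μ)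
    (hsum : Summable μ) (k : ℕ) :
    p * ∑' l, μ (k + 1, l) = r * ∑' l, μ (k, l) := by
  have hs (i) : Summable fun l => μ (i, l) := hsum.prod_factor i
  have hsplit (i) : ∑' l, μ (i, l) = μ (i, 0) + ∑' l, μ (i, l + 1) := (hs i).tsum_eq_zero_add
  have hs' (i) : Summable fun l => μ (i, l + 1) := (summable_nat_add_iff 1).2 (hs i)
  induction k with
  | zero =>
    have h0 := hb 0 0
    -- The equation at `l = 0` has no South outflow, so it is kept apart as `h0`. Once all rows are
    -- added, the South terms cancel.
    have h : ∑' l, (q + r) * μ (0, l + 1) =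
        ∑' l, (p * μ (1, l + 1) + q * μ (0, l + 1 + 1)) := by
      refine tsum_congr fun l => ?_
      have := hb 0 (l + 1)
      simp [totalRate, southWest] at this ⊢
      linarith
    have hs'' : Summable fun l => μ (0, l + 1 + 1) := (summable_nat_add_iff 2).2 (hs 0)
    rw [((hs' 1).mul_left p).tsum_add (hs''.mul_left q), tsum_mul_left, tsum_mul_left,
      tsum_mul_left] at h
    have h1 : ∑' l, μ (0, l + 1) = μ (0, 1) + ∑' l, μ (0, l + 1 + 1) := (hs' 0).tsum_eq_zero_add
    simp [totalRate, southWest] at h0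
    rw [zero_add, hsplit 0, hsplit 1]
    linear_combination -h - h0 + q * h1
  | succ k ih =>
    have h0 := hb (k + 1) 0
    -- Summing over `l` gives `(p + r) m (k+1) = p m (k+2) + r m k` for the marginal `m`; the
    -- induction hypothesis removes `r m k`.
    have h : ∑' l, (p + q + r) * μ (k + 1, l + 1) =
        ∑' l, (p * μ (k + 2, l + 1) + q * μ (k + 1, l + 1 + 1) + r * μ (k, l)) := by
      refine tsum_congr fun l => ?_
      have := hb (k + 1) (l + 1)
      simp [totalRate, southWest] at this ⊢
      linarith
    have hs'' : Summable fun l => μ (k + 1, l + 1 + 1) := (summable_nat_add_iff 2).2 (hs (k + 1))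
    rw [(((hs' _).mul_left p).add (hs''.mul_left q)).tsum_add ((hs k).mul_left r),
      ((hs' _).mul_left p).tsum_add (hs''.mul_left q), tsum_mul_left, tsum_mul_left,
      tsum_mul_left, tsum_mul_left] at h
    have h1 : ∑' l, μ (k + 1, l + 1) = μ (k + 1, 1) + ∑' l, μ (k + 1, l + 1 + 1) :=
      (hs' (k + 1)).tsum_eq_zero_add
    simp [totalRate, southWest] at h0
    have e1 := hsplit (k + 1)
    have e2 := hsplit (k + 1 + 1)
    linear_combination -h - h0 + q * h1 + p * e2 - (p + r) * e1 + ih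

theorem IsBalanced.lt_of_summable {p q r : ℝ} (hp : 0 < p) (hr : 0 < r) {μ : ℕ × ℕ → ℝ}
    (hb : IsBalanced p q r μ) (hsum : Summable μ) (hpos : 0 < ∑' s, μ s) :
    r < p := by
  obtain ⟨m, hm⟩ : ∃ m, ∀ k, ∑' l, μ (k, l) = m * (r / p) ^ k := by
    refine ⟨∑' l, μ (0, l), fun k => ?_⟩
    induction k with
    | zero => simp
    | succ k ih =>
      have := hb.marginal hsum k
      rw [ih] at this
      rw [pow_succ]
      field_simp at this ⊢
      linarith
  have hne : m ≠ 0 := by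
    intro h
    rw [hsum.tsum_prod] at hpos
    simp [hm, h] at hpos
  have hs : Summable fun k => ∑' l, μ (k, l) := hsum.prod
  simp only [hm] at hs
  rw [summable_mul_left_iff hne, summable_geometric_iff_norm_lt_one, Real.norm_of_nonneg
    (div_nonneg hr.le hp.le), div_lt_one hp] at hs
  exact hs

/-! ### Sufficiency: monotone iteration of joint tails -/

/-- The threshold that one coordinate has to reach before a unit decrease, truncated at `0`, for it
to be at least `a` afterwards. -/
def raise (a : ℕ) : ℕ := if a = 0 then 0 else a + 1

/-- One step of the uniformized chain, acting on joint tail functions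
`G (a, b) = P (X ≥ a, Y ≥ b)`. -/
def tailStep (p q r : ℝ) (G : ℕ × ℕ → ℝ) (s : ℕ × ℕ) : ℝ :=
  -- Truncated subtraction is right here: `X + 1 ≥ a` iff `X ≥ a - 1` in `ℕ`, even for `a = 0`.
  p * G (raise s.1, s.2) + q * G (s.1, raise s.2) + r * G (s.1 - 1, s.2 - 1)

/-- The mass function of a joint tail function. -/
def massOfTail (G : ℕ × ℕ → ℝ) (s : ℕ × ℕ) : ℝ :=
  G s - G (s.1 + 1, s.2) - G (s.1, s.2 + 1) + G (s.1 + 1, s.2 + 1)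

/-- The last term is the mass that pauses on the axes because its step is suppressed. -/
theorem massOfTail_tailStep (p q r : ℝ) (G : ℕ × ℕ → ℝ) (k l : ℕ) :
    massOfTail (tailStep p q r G) (k, l) =
      p * massOfTail G (k + 1, l) + q * massOfTail G (k, l + 1) +
        r * southWest (massOfTail G) (k, l) +
      ((if k = 0 then p else 0) + (if l = 0 then q else 0)) * massOfTail G (k, l) := by
  rcases k with _ | k <;> rcases l with _ | l <;>
    simp [massOfTail, tailStep, southWest, raise] <;> ring

theorem isBalanced_massOfTail {p q r : ℝ} (h : p + q + r = 1) {G : ℕ × ℕ → ℝ}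
    (hG : tailStep p q r G = G) : IsBalanced p q r (massOfTail G) := by
  intro k l
  have := massOfTail_tailStep p q r G k l
  rw [hG] at this
  have hc : totalRate p q r (k, l) = 1 - ((if k = 0 then p else 0) + (if l = 0 then q else 0)) := by
    simp only [totalRate]
    split_ifs <;> linarith
  rw [hc]
  linarith

theorem tailStep_mono {p q r : ℝ} (hp : 0 < p) (hq : 0 < q) (hr : 0 < r) :
    Monotone (tailStep p q r) := by
  intro G H h s
  unfold tailStep
  gcongr <;> exact h _

/-- For `a > 0` this is `p x ^ 2 + q x + r = x` at `x = r / p`, which holds because `p x ^ 2 - (p +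
r) x + r = (x - 1) (p x - r)`. -/
theorem tailStep_geometric_fst {p q r : ℝ} (hp : 0 < p) (h : p + q + r = 1) :
    tailStep p q r (fun s => (r / p) ^ s.1) = fun s => (r / p) ^ s.1 := by
  funext ⟨a, b⟩
  rcases a with _ | a
  · simp [tailStep, raise, h]
  · have hpr : p * (r / p) = r := mul_div_cancel₀ r hp.ne'
    simp only [tailStep, raise, Nat.add_eq_zero_iff, one_ne_zero, and_false, if_false,
      Nat.add_sub_cancel, pow_succ]
    linear_combination (r / p) ^ a * (r / p - 1) * hpr + (r / p) ^ a * (r / p) * h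

theorem tailStep_geometric_snd {p q r : ℝ} (hq : 0 < q) (h : p + q + r = 1) :
    tailStep p q r (fun s => (r / q) ^ s.2) = fun s => (r / q) ^ s.2 := by
  funext ⟨a, b⟩
  have := congrFun (tailStep_geometric_fst (q := p) (r := r) hq (by linarith)) (b, a)
  simp only [tailStep] at this ⊢
  linarith

/-- The joint tail function of the uniformized chain started at the origin after `n` steps. -/
def iterTail (p q r : ℝ) (n : ℕ) : ℕ × ℕ → ℝ :=
  (tailStep p q r)^[n] (fun s => if s = (0, 0) then 1 else 0)

theorem iterTail_succ (p q r : ℝ) (n : ℕ) :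
    iterTail p q r (n + 1) = tailStep p q r (iterTail p q r n) :=
  Function.iterate_succ_apply' _ _ _

theorem iterTail_le {p q r : ℝ} (hp : 0 < p) (hq : 0 < q) (hr : 0 < r) {H : ℕ × ℕ → ℝ}
    (h0 : ∀ s, 0 ≤ H s) (h1 : H (0, 0) = 1) (hH : tailStep p q r H = H) (n : ℕ) :
    iterTail p q r n ≤ H := by
  induction n with
  | zero =>
    intro s
    simp only [iterTail, Function.iterate_zero, id]
    split_ifs with h
    · rw [h, h1]
    · exact h0 s
  | succ n ih =>
    rw [iterTail_succ, ← hH]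
    exact tailStep_mono hp hq hr ih

/-- The origin is the least state, so the first step can only raise the tails; monotonicity of
`tailStep` propagates this. -/
theorem iterTail_mono {p q r : ℝ} (hp : 0 < p) (hq : 0 < q) (hr : 0 < r) (h : p + q + r = 1) :
    Monotone (iterTail p q r) := by
  refine Monotone.monotone_iterate_of_le_map (tailStep_mono hp hq hr) ?_
  rintro ⟨a, b⟩
  simp only [tailStep]
  by_cases hab : a = 0 ∧ b = 0
  · simp [hab.1, hab.2, raise, h]
  · rw [if_neg (by simpa using hab)]
    positivity

theorem iterTail_zero_zero {p q r : ℝ} (h : p + q + r = 1) (n : ℕ) :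
    iterTail p q r n (0, 0) = 1 := by
  induction n with
  | zero => simp [iterTail]
  | succ n ih => simp [iterTail_succ, tailStep, raise, ih, h]

theorem massOfTail_iterTail_nonneg {p q r : ℝ} (hp : 0 < p) (hq : 0 < q) (hr : 0 < r) (n : ℕ)
    (s : ℕ × ℕ) : 0 ≤ massOfTail (iterTail p q r n) s := by
  induction n generalizing s with
  | zero =>
    simp only [massOfTail, iterTail, Function.iterate_zero, id]
    split_ifs <;> simp_all
  | succ n ih =>
    obtain ⟨k, l⟩ := s
    have hsw : 0 ≤ southWest (massOfTail (iterTail p q r n)) (k, l) := by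
      rcases k with _ | k <;> rcases l with _ | l <;> simp [southWest, ih]
    have hif : 0 ≤ (if k = 0 then p else 0) + (if l = 0 then q else 0) := by
      split_ifs <;> linarith
    rw [iterTail_succ, massOfTail_tailStep]
    have := ih (k + 1, l)
    have := ih (k, l + 1)
    have := ih (k, l)
    positivity

theorem sum_massOfTail (G : ℕ × ℕ → ℝ) (N : ℕ) :
    ∑ s ∈ Finset.range N ×ˢ Finset.range N, massOfTail G s =
      G (0, 0) - G (N, 0) - G (0, N) + G (N, N) := by
  have hrow (k) : ∑ l ∈ Finset.range N, massOfTail G (k, l) =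
      (G (k, 0) - G (k, N)) - (G (k + 1, 0) - G (k + 1, N)) := by
    rw [← Finset.sum_range_sub' (fun l => G (k, l)), ← Finset.sum_range_sub' (fun l => G (k + 1, l)),
      ← Finset.sum_sub_distrib]
    exact Finset.sum_congr rfl fun l _ => by simp only [massOfTail]; ring
  rw [Finset.sum_product, Finset.sum_congr rfl fun k _ => hrow k,
    Finset.sum_range_sub' (fun k => G (k, 0) - G (k, N))]
  ring

/-- A nonnegative function on the quadrant whose sums over squares converge is summable. -/
theorem hasSum_of_tendsto_sum_squares {f : ℕ × ℕ → ℝ} (h0 : ∀ s, 0 ≤ f s) {a : ℝ}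
    (h : Tendsto (fun N => ∑ s ∈ Finset.range N ×ˢ Finset.range N, f s) atTop (𝓝 a)) :
    HasSum f a := by
  have hsqm : Monotone fun N : ℕ => Finset.range N ×ˢ Finset.range N := fun M N hMN =>
    Finset.product_subset_product (Finset.range_mono hMN) (Finset.range_mono hMN)
  have hsq : Tendsto (fun N : ℕ => Finset.range N ×ˢ Finset.range N) atTop atTop := by
    refine tendsto_atTop_finset_of_monotone hsqm fun s => ⟨s.1 + s.2 + 1, ?_⟩
    simp only [Finset.mem_product, Finset.mem_range]
    omega
  have hmono : Monotone fun u : Finset (ℕ × ℕ) => ∑ s ∈ u, f s := fun u v huv =>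
    Finset.sum_le_sum_of_subset_of_nonneg huv fun s _ _ => h0 s
  have hsum : Summable f := by
    refine summable_of_sum_le h0 (c := a) fun u => ?_
    obtain ⟨N, hN⟩ := (hsq.eventually_ge_atTop u).exists
    exact (hmono hN).trans (Monotone.ge_of_tendsto (fun M N hMN => hmono (hsqm hMN)) h N)
  rw [tendsto_nhds_unique h (hsum.hasSum.comp hsq)]
  exact hsum.hasSum

theorem exists_isBalanced {p q r : ℝ} (hp : 0 < p) (hq : 0 < q) (hr : 0 < r)
    (h : p + q + r = 1) (hrp : r < p) (hrq : r < q) :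
    ∃ μ : ℕ × ℕ → ℝ, (∀ s, 0 ≤ μ s) ∧ HasSum μ 1 ∧ IsBalanced p q r μ := by
  have hp0 : 0 ≤ r / p := by positivity
  have hq0 : 0 ≤ r / q := by positivity
  have hle1 (n) : iterTail p q r n ≤ fun s => (r / p) ^ s.1 :=
    iterTail_le hp hq hr (fun s => pow_nonneg hp0 _) (by simp) (tailStep_geometric_fst hp h) n
  have hle2 (n) : iterTail p q r n ≤ fun s => (r / q) ^ s.2 :=
    iterTail_le hp hq hr (fun s => pow_nonneg hq0 _) (by simp) (tailStep_geometric_snd hq h) n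
  set G : ℕ × ℕ → ℝ := fun s => ⨆ n, iterTail p q r n s with hGdef
  have hlim (s) : Tendsto (fun n => iterTail p q r n s) atTop (𝓝 (G s)) :=
    tendsto_atTop_ciSup (fun m n hmn => iterTail_mono hp hq hr h hmn s)
      ⟨(r / p) ^ s.1, by rintro _ ⟨n, rfl⟩; exact hle1 n s⟩
  have hG0 (s) : 0 ≤ G s := by
    refine ge_of_tendsto' (hlim s) fun n => le_trans ?_ (iterTail_mono hp hq hr h (Nat.zero_le n) s)
    simp only [iterTail, Function.iterate_zero, id]
    split_ifs <;> norm_num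
  have hG1 (s) : G s ≤ (r / p) ^ s.1 := le_of_tendsto' (hlim s) fun n => hle1 n s
  have hG2 (s) : G s ≤ (r / q) ^ s.2 := le_of_tendsto' (hlim s) fun n => hle2 n s
  have hG00 : G (0, 0) = 1 := by simp [hGdef, iterTail_zero_zero h]
  have hfix : tailStep p q r G = G := by
    funext s
    refine tendsto_nhds_unique ?_ ((tendsto_add_atTop_iff_nat 1).2 (hlim s))
    simp only [iterTail_succ, tailStep]
    exact (((hlim _).const_mul p).add ((hlim _).const_mul q)).add ((hlim _).const_mul r)
  have hnonneg (s) : 0 ≤ massOfTail G s :=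
    ge_of_tendsto' ((((hlim s).sub (hlim _)).sub (hlim _)).add (hlim _))
      fun n => massOfTail_iterTail_nonneg hp hq hr n s
  have hpow1 : Tendsto (fun N : ℕ => (r / p) ^ N) atTop (𝓝 0) :=
    tendsto_pow_atTop_nhds_zero_of_lt_one hp0 ((div_lt_one hp).2 hrp)
  have hpow2 : Tendsto (fun N : ℕ => (r / q) ^ N) atTop (𝓝 0) :=
    tendsto_pow_atTop_nhds_zero_of_lt_one hq0 ((div_lt_one hq).2 hrq)
  refine ⟨massOfTail G, hnonneg, hasSum_of_tendsto_sum_squares hnonneg ?_,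
    isBalanced_massOfTail h hfix⟩
  -- The mass outside a square is controlled by tails: `r < p` makes `G (N, 0)` vanish, `r < q`
  -- makes `G (0, N)` vanish.
  simp only [sum_massOfTail, hG00]
  have t1 : Tendsto (fun N => G (N, 0)) atTop (𝓝 0) :=
    squeeze_zero (fun N => hG0 _) (fun N => hG1 (N, 0)) hpow1
  have t2 : Tendsto (fun N => G (0, N)) atTop (𝓝 0) :=
    squeeze_zero (fun N => hG0 _) (fun N => hG2 (0, N)) hpow2
  have t3 : Tendsto (fun N => G (N, N)) atTop (𝓝 0) :=
    squeeze_zero (fun N => hG0 _) (fun N => hG1 (N, N)) hpow1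
  simpa using ((t1.const_sub 1).sub t2).add t3

/-- If `p : r = p' : r'` and `p' + r' = 1` then `p'` and `r'` are the normalized rates. -/
theorem mul_add_eq_of_div_eq_div {p r p' r' : ℝ} (hr : 0 < r) (hr' : 0 < r')
    (h1 : p' + r' = 1) (h : p / r = p' / r') : p' * (p + r) = p ∧ r' * (p + r) = r := by
  rw [div_eq_div_iff hr.ne' hr'.ne'] at h
  constructor
  · linear_combination p * h1 - h
  · linear_combination r * h1 + h

end QuadrantChain

theorem mainTheorem8 (p q r p' r' q'' r'' : ℝ)
    (hp : 0 < p) (hq : 0 < q) (hr : 0 < r) (hpqr : p + q + r = 1)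
    (hp' : 0 < p') (hr' : 0 < r') (hpr' : p' + r' = 1)
    (hq'' : 0 < q'') (hr'' : 0 < r'') (hqr'' : q'' + r'' = 1)
    (hα : p / r = p' / r') (hβ : q / r = q'' / r'') :
    QuadrantChain.IsErgodicChain (QuadrantChain.transition p q r p' r' q'' r'') ↔
      r < min p q := by
  obtain ⟨h1, h2⟩ := QuadrantChain.mul_add_eq_of_div_eq_div hr hr' hpr' hα
  obtain ⟨h3, h4⟩ := QuadrantChain.mul_add_eq_of_div_eq_div hr hr'' hqr'' hβ
  rw [QuadrantChain.isErgodicChain_iff_exists_isBalanced hp hq hr hpqr h1 h2 h3 h4, lt_min_iff]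
  constructor
  · rintro ⟨μ, -, hsum, hpos, hb⟩
    refine ⟨hb.lt_of_summable hp hr hsum hpos,
      hb.swap.lt_of_summable hq hr ?_ ?_⟩
    · exact (Equiv.prodComm ℕ ℕ).summable_iff.2 hsum
    · rwa [show ∑' s, (μ ∘ Prod.swap) s = ∑' s, μ s from (Equiv.prodComm ℕ ℕ).tsum_eq μ]
  · rintro ⟨hrp, hrq⟩
    obtain ⟨μ, h0, hsum, hb⟩ := QuadrantChain.exists_isBalanced hp hq hr hpqr hrp hrq
    exact ⟨μ, h0, hsum.summable, by rw [hsum.tsum_eq]; exact one_pos, hb⟩
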